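/- Let $E$ be a complex Banach lattice with real part $E_{\mathbb{R}}$ and positive cone $E_+$, and let $(e^{tA})_{t\ge 0}$ be a $C_0$-semigroup on $E$ with generator $A$. Write $E'$ for the dual Banach space of $E$ and $A'$ for the dual operator of $A$. Assume that: - the semigroup is real, i.e. $e^{tA}E_{\mathbb{R}}\subseteq E_{\mathbb{R}}$ for all $t\ge 0$; - the semigroup is individually eventually positive, i.e. for each $f\in E_+$ there is $t_0\ge 0$ such that $e^{tA}f\ge 0$ for all $t\ge t_0$; - the semigroup is persistently irreducible, i.e. if $I\subseteq E$ is a closed ideal (a closed vector subspace such that $|f|\le|g|$ and $g\in I$ imply $f\in I$) for which there is $t_0\ge 0$ with $e^{tA}I\subseteq I$ for all $t\ge t_0$, then $I=\{0\}$ or $I=E$. Let $\lambda\in\mathbb{R}$ be an eigenvalue of both $A$ and $A'$, and assume that $\ker(\lambda-A')$ contains a positive non-zero functional. Then: 1. $\lambda$ is algebraically simple as an eigenvalue of $A$, i.e. the generalized eigenspace $\bigcup_{n\in\mathbb{N}}\ker\big((\lambda-A)^n\big)$ is one-dimensional; 2. the eigenspace $\ker(\lambda-A)$ is spanned over $\mathbb{C}$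 by a quasi-interior point $u$ of $E_+$, i.e. by some $u\in E_+$ whose principal ideal $\{f\in E : |f|\le cu \text{ for some } c>0\}$ is dense in $E$; 3. $\ker(\lambda-A')$ contains a strictly positive functional, i.e. a positive functional whose kernel contains no positive non-zero element of $E$. -/

import Mathlib

open Filter Topology
open scoped NNReal

/-- A structure of complex Banach lattice on a complex Banach space `E` (completeness is a separate
type-class argument). `E` is the complexification of a real normed vector lattice `realPart`,
every `z = x + i y` has the modulus `|z| = sup_θ (cos θ • x + sin θ • y)`,
and the norm of `E` is `‖z‖ = ‖|z|‖`. -/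
class ComplexBanachLattice (E : Type*) [NormedAddCommGroup E] [NormedSpace ℂ E] where
  /-- The real part of `E`. -/
  realPart : Submodule ℝ E
  [lattice : Lattice realPart]
  [isOrderedAddMonoid : IsOrderedAddMonoid realPart]
  [isOrderedModule : IsOrderedModule ℝ realPart]
  [hasSolidNorm : HasSolidNorm realPart]
  existsUnique_re_im : ∀ z : E, ∃! p : realPart × realPart,
    z = (p.1 : E) + Complex.I • (p.2 : E)
  /-- The modulus `|z|` of `z : E`. -/
  modulus : E → realPart
  isLUB_modulus : ∀ x y : realPart,
    IsLUB (Set.range fun θ : ℝ => Real.cos θ • x + Real.sin θ • y)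
      (modulus ((x : E) + Complex.I • (y : E)))
  norm_modulus : ∀ z : E, ‖modulus z‖ = ‖z‖

namespace ComplexBanachLattice

attribute [reducible] lattice

attribute [instance] lattice isOrderedAddMonoid isOrderedModule hasSolidNorm

section Basic

variable {E : Type*} [NormedAddCommGroup E] [NormedSpace ℂ E] [ComplexBanachLattice E]

/-- `z ∈ E` belongs to the positive cone of `E`. -/
def IsPositive (z : E) : Prop :=
  ∃ h : z ∈ realPart (E := E), 0 ≤ (⟨z, h⟩ : realPart (E := E))

/-- A vector subspace `I` is an ideal if `|f| ≤ |g|` and `g ∈ I` imply `f ∈ I`. -/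
def IsIdeal (I : Submodule ℂ E) : Prop :=
  ∀ f g : E, modulus f ≤ modulus g → g ∈ I → f ∈ I

/-- The principal ideal `E_u = {f | ∃ c > 0, |f| ≤ c u}`, as a set. -/
def principalIdeal (u : realPart (E := E)) : Set E :=
  {f | ∃ c : ℝ, 0 < c ∧ modulus f ≤ c • u}

/-- `u` is a quasi-interior point of the positive cone. -/
def IsQuasiInterior (u : realPart (E := E)) : Prop :=
  0 ≤ u ∧ Dense (principalIdeal u)

/-- A bounded operator is real if it maps the real part of `E` to itself. -/
def IsRealOperator (S : E →L[ℂ] E) : Prop :=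
  ∀ x : E, x ∈ realPart (E := E) → S x ∈ realPart (E := E)

/-- Positivity of a functional `φ ∈ E'`: `φ f ∈ [0, ∞)` for all `f ≥ 0`. -/
def IsPositiveFunctional (φ : StrongDual ℂ E) : Prop :=
  ∀ f : E, IsPositive f → 0 ≤ (φ f).re ∧ (φ f).im = 0

/-- A positive functional is strictly positive if its kernel contains no positive non-zero
element. -/
def IsStrictlyPositiveFunctional (φ : StrongDual ℂ E) : Prop :=
  IsPositiveFunctional φ ∧ ∀ f : E, IsPositive f → φ f = 0 → f = 0

end Basic

end ComplexBanachLattice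

/-- A strongly continuous semigroup of bounded linear operators on `E`. -/
structure C0Semigroup (E : Type*) [NormedAddCommGroup E] [NormedSpace ℂ E] where
  /-- The operator at time `t`. -/
  op : ℝ≥0 → E →L[ℂ] E
  op_zero : op 0 = ContinuousLinearMap.id ℂ E
  op_add : ∀ s t : ℝ≥0, op (s + t) = (op s).comp (op t)
  continuous_op : ∀ x : E, Continuous fun t : ℝ≥0 => op t x

namespace C0Semigroup

section Generator

variable {E : Type*} [NormedAddCommGroup E] [NormedSpace ℂ E]

/-- The graph of the generator: all `(x, y)` with `(T t x - x) / t → y` as `t ↓ 0`. -/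
def generatorGraph (T : C0Semigroup E) : Submodule ℂ (E × E) where
  carrier := {p | Tendsto (fun t : ℝ≥0 => (t : ℝ)⁻¹ • (T.op t p.1 - p.1)) (𝓝[>] 0) (𝓝 p.2)}
  zero_mem' := by simp
  add_mem' := by
    intro p q hp hq
    have h := Filter.Tendsto.add hp hq
    refine h.congr fun t => ?_
    simp only [Prod.fst_add, map_add, ← smul_add]
    congr 1
    abel
  smul_mem' := by
    intro c p hp
    have h := Filter.Tendsto.const_smul hp c
    refine h.congr fun t => ?_
    simp only [Prod.smul_fst, map_smul, ← smul_sub]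
    rw [smul_comm]

/-- The generator `A` of the semigroup, an unbounded operator on `E`. -/
noncomputable def generator (T : C0Semigroup E) : E →ₗ.[ℂ] E :=
  T.generatorGraph.toLinearPMap

theorem generator_graph (T : C0Semigroup E) : T.generator.graph = T.generatorGraph := by
  refine Submodule.toLinearPMap_graph_eq _ fun p hp h0 => ?_
  have h : Tendsto (fun t : ℝ≥0 => (t : ℝ)⁻¹ • (T.op t p.1 - p.1)) (𝓝[>] 0) (𝓝 p.2) := hp
  simp only [h0, map_zero, sub_zero, smul_zero] at h
  exact (tendsto_nhds_unique h tendsto_const_nhds)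

end Generator

section Order

variable {E : Type*} [NormedAddCommGroup E] [NormedSpace ℂ E] [ComplexBanachLattice E]

open ComplexBanachLattice

/-- The semigroup is real. -/
def IsReal (T : C0Semigroup E) : Prop :=
  ∀ t : ℝ≥0, IsRealOperator (T.op t)

/-- For each `f ≥ 0` there is `t₀` with `T t f ≥ 0` for all `t ≥ t₀`. -/
def IsIndividuallyEventuallyPositive (T : C0Semigroup E) : Prop :=
  ∀ f : E, IsPositive f → ∃ t₀ : ℝ≥0, ∀ t : ℝ≥0, t₀ ≤ t → IsPositive (T.op t f)

/-- There is `t₀` with `T t S ⊆ S` for all `t ≥ t₀`. -/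
def IsUniformlyEventuallyInvariant (T : C0Semigroup E) (S : Set E) : Prop :=
  ∃ t₀ : ℝ≥0, ∀ t : ℝ≥0, t₀ ≤ t → Set.MapsTo (T.op t) S S

/-- The only uniformly eventually invariant closed ideals are `{0}` and `E`. -/
def IsPersistentlyIrreducible (T : C0Semigroup E) : Prop :=
  ∀ I : Submodule ℂ E, IsIdeal I → IsClosed (I : Set E) →
    T.IsUniformlyEventuallyInvariant (I : Set E) → I = ⊥ ∨ I = ⊤

end Order

end C0Semigroup

namespace UnboundedOperator

section Dual

variable {X : Type*} [NormedAddCommGroup X] [NormedSpace ℂ X]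

/-- All `(φ, ψ) ∈ X' × X'` with `⟨φ, A x⟩ = ⟨ψ, x⟩` for every `x` in the domain of `A`. -/
def dualGraph (A : X →ₗ.[ℂ] X) : Submodule ℂ (StrongDual ℂ X × StrongDual ℂ X) where
  carrier := {p | ∀ x : A.domain, p.1 (A x) = p.2 (x : X)}
  zero_mem' := by simp
  add_mem' := by
    intro p q hp hq x
    simp [hp x, hq x]
  smul_mem' := by
    intro c p hp x
    simp [hp x]

/-- The dual operator `A'` on `X'` of a densely defined operator `A` on `X`. -/
noncomputable def dual (A : X →ₗ.[ℂ] X) : StrongDual ℂ X →ₗ.[ℂ] StrongDual ℂ X :=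
  (dualGraph A).toLinearPMap

theorem dual_graph (A : X →ₗ.[ℂ] X) (hA : Dense (A.domain : Set X)) :
    (dual A).graph = dualGraph A := by
  refine Submodule.toLinearPMap_graph_eq _ fun p hp h0 => ?_
  have h : ∀ x : A.domain, p.1 (A x) = p.2 (x : X) := hp
  have h2 : (p.2 : X → ℂ) = (0 : StrongDual ℂ X) :=
    Continuous.ext_on hA p.2.continuous (0 : StrongDual ℂ X).continuous fun x hx => by
      simpa [h0] using (h ⟨x, hx⟩).symm
  exact DFunLike.coe_injective h2

end Dual

section Spectral

variable {X : Type*} [AddCommGroup X] [Module ℂ X]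

/-- The kernel of `(μ - A) ^ n`, including the domain condition: `x ∈ ker (μ - A) ^ (n + 1)` iff
`x` is in the domain of `A` and `(μ - A) x ∈ ker (μ - A) ^ n`. -/
def kerPow (A : X →ₗ.[ℂ] X) (μ : ℂ) : ℕ → Submodule ℂ X
  | 0 => ⊥
  | n + 1 => ((kerPow A μ n).comap (μ • A.domain.subtype - A.toFun)).map A.domain.subtype

theorem mem_kerPow_succ (A : X →ₗ.[ℂ] X) (μ : ℂ) (n : ℕ) (x : X) :
    x ∈ kerPow A μ (n + 1) ↔ ∃ h : x ∈ A.domain, μ • x - A ⟨x, h⟩ ∈ kerPow A μ n := by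
  simp [kerPow]

theorem kerPow_mono (A : X →ₗ.[ℂ] X) (μ : ℂ) : Monotone (kerPow A μ) := by
  refine monotone_nat_of_le_succ fun n => ?_
  induction n with
  | zero => exact bot_le
  | succ n ih =>
    intro x hx
    rw [mem_kerPow_succ] at hx ⊢
    exact hx.imp fun _ hx => ih hx

/-- The eigenspace `ker (μ - A)`. -/
def eigenspace (A : X →ₗ.[ℂ] X) (μ : ℂ) : Submodule ℂ X :=
  (LinearMap.ker (μ • A.domain.subtype - A.toFun)).map A.domain.subtype

theorem mem_eigenspace (A : X →ₗ.[ℂ] X) (μ : ℂ) (x : X) :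
    x ∈ eigenspace A μ ↔ ∃ h : x ∈ A.domain, A ⟨x, h⟩ = μ • x := by
  simp only [eigenspace, Submodule.mem_map, LinearMap.mem_ker, Subtype.exists, LinearMap.sub_apply,
    LinearMap.smul_apply, Submodule.subtype_apply, sub_eq_zero, LinearPMap.toFun_eq_coe]
  constructor
  · rintro ⟨y, hy, h, rfl⟩
    exact ⟨hy, h.symm⟩
  · rintro ⟨hx, h⟩
    exact ⟨x, hx, h.symm, rfl⟩

/-- `μ` is an eigenvalue of `A`. -/
def IsEigenvalue (A : X →ₗ.[ℂ] X) (μ : ℂ) : Prop :=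
  ∃ x ∈ eigenspace A μ, x ≠ 0

/-- The generalized eigenspace `⋃ n, ker (μ - A) ^ n`. -/
def generalizedEigenspace (A : X →ₗ.[ℂ] X) (μ : ℂ) : Submodule ℂ X where
  carrier := ⋃ n : ℕ, (kerPow A μ n : Set X)
  zero_mem' := Set.mem_iUnion.2 ⟨0, zero_mem _⟩
  add_mem' := by
    intro x y hx hy
    obtain ⟨m, hm⟩ := Set.mem_iUnion.1 hx
    obtain ⟨n, hn⟩ := Set.mem_iUnion.1 hy
    exact Set.mem_iUnion.2 ⟨max m n, add_mem (kerPow_mono A μ (le_max_left m n) hm)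
      (kerPow_mono A μ (le_max_right m n) hn)⟩
  smul_mem' := by
    intro c x hx
    obtain ⟨n, hn⟩ := Set.mem_iUnion.1 hx
    exact Set.mem_iUnion.2 ⟨n, Submodule.smul_mem _ c hn⟩

/-- The generalized eigenspace is one-dimensional. -/
def IsAlgebraicallySimple (A : X →ₗ.[ℂ] X) (μ : ℂ) : Prop :=
  Module.finrank ℂ (generalizedEigenspace A μ) = 1

end Spectral

end UnboundedOperator

/-! Pass to the rescaled semigroup `S t = e^{-μ t} T t` on the real part: eigenvectors of `A` become
fixed vectors and the given functional `φ` becomes invariant. The obstacle is that positivity starts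
at a time depending on the vector, whereas persistent irreducibility only speaks about ideals
invariant from a uniform time on. Baire's theorem on a closed convex set removes this dependence
(`exists_uniform_time`), and is used twice. On the null ideal `{f | φ |f| = 0}` it yields uniform
eventual invariance, so this ideal is zero and `φ` is strictly positive. On the order interval `[-v,
v]` of a positive non-zero fixed vector `v` it yields uniform eventual invariance of the closed
ideal generated by `v`, so `v` is quasi-interior. If `u` is fixed, then eventually `|u| ≤ S t |u|`;
both sides have the same value under `φ`, so they agree and the fixed space is a sublattice. If a
fixed `z` satisfies `φ z = 0`, then a non-zero `z⁺` would be quasi-interior and disjoint from `z⁻`,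
forcing `z⁻ = 0` and `φ z⁺ = 0`, a contradiction. Hence `φ` is injective on the fixed space, which
is therefore one-dimensional. Finally `φ` vanishes on the range of `μ - A` but not at `v`, so this
range meets the eigenspace only in zero: there are no generalized eigenvectors of higher order. -/

/-! ### Baire's theorem on closed convex sets -/

section Baire

variable {X : Type*} [NormedAddCommGroup X] [NormedSpace ℝ X] [CompleteSpace X]

/-- A nonempty closed convex set which is covered by countably many closed subspaces is contained
in one of them. -/
theorem Convex.exists_subset_of_subset_iUnion_submodule {C : Set X} (hconv : Convex ℝ C)
    (hclosed : IsClosed C) (hne : C.Nonempty) (F : ℕ → Submodule ℝ X)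
    (hF : ∀ n, IsClosed (F n : Set X)) (hcover : ∀ x ∈ C, ∃ n, x ∈ F n) :
    ∃ n, C ⊆ F n := by
  have : CompleteSpace C := hclosed.completeSpace_coe
  have : Nonempty C := hne.to_subtype
  -- Baire is applied to `C` itself, so the interior is relative to `C`.
  obtain ⟨n, x, hx⟩ := nonempty_interior_of_iUnion_of_closed
    (f := fun n => ((↑) : C → X) ⁻¹' (F n : Set X))
    (fun n => (hF n).preimage continuous_subtype_val)
    (Set.eq_univ_of_forall fun x => Set.mem_iUnion.2 (hcover x x.2))
  refine ⟨n, fun g hg => ?_⟩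
  -- The segment from `x` to `g` stays in `C` by convexity, so for some small `δ ≠ 0` its point lies
  -- in `F n`; subtracting `x` and dividing by `δ` gives `g - x ∈ F n`.
  let γ : unitInterval → C := fun δ =>
    ⟨(x : X) + (δ : ℝ) • (g - x), hconv.add_smul_sub_mem x.2 hg δ.2⟩
  have hγ : Continuous γ := by fun_prop
  have h0 : γ 0 = x := by ext; simp [γ]
  have hmem : γ ⁻¹' (((↑) : C → X) ⁻¹' (F n : Set X)) ∈ 𝓝 (0 : unitInterval) := by
    apply hγ.continuousAt
    rw [h0]
    exact mem_interior_iff_mem_nhds.1 hx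
  have hpos : ∃ᶠ δ : unitInterval in 𝓝 0, δ ≠ 0 := by
    have : (𝓝[≠] (0 : unitInterval)).NeBot := inferInstance
    exact frequently_mem_iff_neBot.2 this
  obtain ⟨δ, hδ0, hδ⟩ := (hpos.and_eventually hmem).exists
  have hxF : x ∈ ((↑) : C → X) ⁻¹' (F n : Set X) := interior_subset hx
  replace hxF : (x : X) ∈ F n := hxF
  have hδ' : (x : X) + (δ : ℝ) • (g - x) ∈ F n := hδ
  have h1 : (δ : ℝ) • (g - x) ∈ F n := (Submodule.add_mem_iff_right _ hxF).1 hδ'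
  have h2 : g - x ∈ F n :=
    ((F n).smul_mem_iff (fun h => hδ0 (Subtype.ext h))).1 h1
  exact (Submodule.sub_mem_iff_left _ hxF).1 h2

end Baire

/-! ### Ideals and disjointness in real vector lattices -/

section VectorLattice

variable {R : Type*} [NormedAddCommGroup R] [NormedSpace ℝ R] [Lattice R]
  [IsOrderedAddMonoid R] [IsOrderedModule ℝ R]

omit [IsOrderedAddMonoid R] in
theorem abs_smul_le_smul_abs_of_vectorLattice (c : ℝ) (f : R) : |c • f| ≤ |c| • |f| := by
  refine abs_le'.2 ⟨?_, ?_⟩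
  · rcases le_total 0 c with hc | hc
    · rw [abs_of_nonneg hc]
      exact smul_le_smul_of_nonneg_left (le_abs_self f) hc
    · rw [abs_of_nonpos hc, ← neg_smul_neg]
      exact smul_le_smul_of_nonneg_left (neg_le_abs f) (neg_nonneg.2 hc)
  · rcases le_total 0 c with hc | hc
    · rw [abs_of_nonneg hc, ← smul_neg]
      exact smul_le_smul_of_nonneg_left (neg_le_abs f) hc
    · rw [abs_of_nonpos hc, ← neg_smul]
      exact smul_le_smul_of_nonneg_left (le_abs_self f) (neg_nonneg.2 hc)

/-- A subspace of a real vector lattice is an order ideal. -/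
def IsOrderIdeal (J : Submodule ℝ R) : Prop :=
  ∀ f g : R, |f| ≤ |g| → g ∈ J → f ∈ J

/-- The principal ideal generated by a positive element of a real vector lattice. -/
def principalOrderIdeal (v : R) (hv : 0 ≤ v) : Submodule ℝ R where
  carrier := {f | ∃ c : ℝ, 0 < c ∧ |f| ≤ c • v}
  zero_mem' := ⟨1, one_pos, by simpa using hv⟩
  add_mem' := by
    rintro f g ⟨a, ha, hf⟩ ⟨b, hb, hg⟩
    refine ⟨a + b, add_pos ha hb, (abs_add_le f g).trans ?_⟩
    rw [add_smul]
    exact add_le_add hf hg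
  smul_mem' := by
    rintro c f ⟨a, ha, hf⟩
    refine ⟨|c| * a + 1, by positivity, (abs_smul_le_smul_abs_of_vectorLattice c f).trans ?_⟩
    rw [add_smul, one_smul, mul_smul]
    exact (smul_le_smul_of_nonneg_left hf (abs_nonneg c)).trans (le_add_of_nonneg_right hv)

theorem isOrderIdeal_principalOrderIdeal (v : R) (hv : 0 ≤ v) :
    IsOrderIdeal (principalOrderIdeal v hv) := by
  rintro f g hfg ⟨c, hc, hg⟩
  exact ⟨c, hc, hfg.trans hg⟩

theorem self_mem_principalOrderIdeal (v : R) (hv : 0 ≤ v) : v ∈ principalOrderIdeal v hv :=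
  ⟨1, one_pos, by rw [one_smul, abs_of_nonneg hv]⟩

omit [IsOrderedModule ℝ R] in
-- The truncation `g ↦ (f ⊓ |g|) ⊔ -|g|` is continuous, maps `J` into itself, and returns `f` as
-- soon as `|f| ≤ |g|`.
theorem IsOrderIdeal.topologicalClosure [HasSolidNorm R] {J : Submodule ℝ R}
    (hJ : IsOrderIdeal J) : IsOrderIdeal J.topologicalClosure := by
  intro f g hfg hg
  have hcont : Continuous fun g : R => (f ⊓ |g|) ⊔ -|g| := by
    have : Continuous fun g : R => |g| := continuous_id.sup continuous_neg
    exact (continuous_const.inf this).sup this.neg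
  have hf : (f ⊓ |g|) ⊔ -|g| = f := by
    rw [inf_eq_left.2 ((le_abs_self f).trans hfg), sup_eq_left]
    exact neg_le.1 ((neg_le_abs f).trans hfg)
  have := map_mem_closure hcont (t := (J : Set R)) hg fun g hg => ?_
  · rwa [hf] at this
  · refine hJ _ g (abs_le'.2 ⟨sup_le inf_le_right (neg_le_self (abs_nonneg g)), ?_⟩) hg
    exact neg_le.1 le_sup_right

/-- The null ideal of a positive functional. -/
def nullIdeal (φ : StrongDual ℝ R) (hφ : ∀ f, 0 ≤ f → 0 ≤ φ f) : Submodule ℝ R where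
  carrier := {f | φ |f| = 0}
  zero_mem' := by simp
  add_mem' := by
    intro f g hf hg
    have h := hφ _ (sub_nonneg.2 (abs_add_le f g))
    rw [map_sub, map_add] at h
    have h' := hφ _ (abs_nonneg (f + g))
    simp only [Set.mem_ofPred_eq] at hf hg ⊢
    linarith
  smul_mem' := by
    intro c f hf
    have h := hφ _ (sub_nonneg.2 (abs_smul_le_smul_abs_of_vectorLattice c f))
    have h' := hφ _ (abs_nonneg (c • f))
    simp only [Set.mem_ofPred_eq] at hf ⊢
    rw [map_sub, map_smul, hf, smul_zero] at h
    linarith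

theorem isOrderIdeal_nullIdeal (φ : StrongDual ℝ R) (hφ : ∀ f, 0 ≤ f → 0 ≤ φ f) :
    IsOrderIdeal (nullIdeal φ hφ) := by
  intro f g hfg hg
  have h := hφ _ (sub_nonneg.2 hfg)
  have h' := hφ _ (abs_nonneg f)
  have hg : φ |g| = 0 := hg
  rw [map_sub, hg] at h
  exact le_antisymm (by linarith) h'

theorem isClosed_nullIdeal [HasSolidNorm R] (φ : StrongDual ℝ R)
    (hφ : ∀ f, 0 ≤ f → 0 ≤ φ f) : IsClosed (nullIdeal φ hφ : Set R) :=
  isClosed_eq (φ.continuous.comp (continuous_id.sup continuous_neg)) continuous_const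

theorem inf_eq_zero_of_le_smul {f g v : R} (hf : 0 ≤ f) (hg : 0 ≤ g) {c : ℝ}
    (hfv : f ≤ c • v) (hvg : v ⊓ g = 0) : f ⊓ g = 0 := by
  -- With `K = max c 1` both `f ≤ K • v` and `g ≤ K • g` hold, so `K⁻¹ • (f ⊓ g)` lies below `v ⊓
  -- g`.
  have hc : (0 : ℝ) < max c 1 := lt_max_of_lt_right one_pos
  have hv : 0 ≤ v := hvg ▸ inf_le_left
  refine le_antisymm ?_ (le_inf hf hg)
  have h1 : (max c 1)⁻¹ • (f ⊓ g) ≤ v ⊓ g := by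
    refine le_inf ?_ ?_
    · rw [inv_smul_le_iff_of_pos hc]
      exact inf_le_left.trans (hfv.trans (smul_le_smul_of_nonneg_right (le_max_left _ _) hv))
    · rw [inv_smul_le_iff_of_pos hc]
      refine inf_le_right.trans ?_
      simpa using smul_le_smul_of_nonneg_right (le_max_right c 1) hg
  rw [hvg, inv_smul_le_iff_of_pos hc, smul_zero] at h1
  exact h1

/-- An element disjoint from a quasi-interior point vanishes. -/
theorem eq_zero_of_disjoint_of_topologicalClosure_eq_top [HasSolidNorm R] {v w : R} (hv : 0 ≤ v)
    (hw : 0 ≤ w) (hdense : (principalOrderIdeal v hv).topologicalClosure = ⊤)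
    (hvw : v ⊓ w = 0) : w = 0 := by
  have hclosed : IsClosed {f : R | |f| ⊓ w = 0} :=
    isClosed_eq ((continuous_id.sup continuous_neg).inf continuous_const) continuous_const
  -- Disjointness from `w` passes from `v` to its ideal and then to the closure, which contains `w`
  -- itself.
  have hsub : closure (principalOrderIdeal v hv : Set R) ⊆ {f : R | |f| ⊓ w = 0} := by
    refine closure_minimal ?_ hclosed
    rintro f ⟨c, -, hf⟩
    exact inf_eq_zero_of_le_smul (abs_nonneg f) hw hf hvw
  have hmem : w ∈ (principalOrderIdeal v hv).topologicalClosure := hdense ▸ Submodule.mem_top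
  have : |w| ⊓ w = 0 := hsub hmem
  rwa [abs_of_nonneg hw, inf_idem] at this

end VectorLattice

/-! ### Individually eventually positive families on a real Banach lattice -/

section RealSemigroup

variable {R : Type*} [NormedAddCommGroup R] [NormedSpace ℝ R]

/-- The subspace of all `f` which are mapped into `J` by all operators from time `t₀` on. -/
def eventualPreimage (S : ℝ≥0 → R →L[ℝ] R) (J : Submodule ℝ R) (t₀ : ℝ≥0) : Submodule ℝ R :=
  ⨅ (t : ℝ≥0) (_ : t₀ ≤ t), J.comap (S t : R →ₗ[ℝ] R)

theorem mem_eventualPreimage {S : ℝ≥0 → R →L[ℝ] R} {J : Submodule ℝ R} {t₀ : ℝ≥0} {f : R} :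
    f ∈ eventualPreimage S J t₀ ↔ ∀ t, t₀ ≤ t → S t f ∈ J := by
  simp [eventualPreimage, Submodule.mem_iInf]

theorem isClosed_eventualPreimage (S : ℝ≥0 → R →L[ℝ] R) {J : Submodule ℝ R}
    (hJ : IsClosed (J : Set R)) (t₀ : ℝ≥0) :
    IsClosed (eventualPreimage S J t₀ : Set R) := by
  have : (eventualPreimage S J t₀ : Set R) = ⋂ (t : ℝ≥0) (_ : t₀ ≤ t), S t ⁻¹' J := by
    ext f
    simp [mem_eventualPreimage]
  rw [this]
  exact isClosed_iInter fun t => isClosed_iInter fun _ => hJ.preimage (S t).continuous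

/-- If every element of a closed convex set is eventually mapped into a closed subspace, then this
happens uniformly. -/
theorem exists_uniform_time [CompleteSpace R] (S : ℝ≥0 → R →L[ℝ] R) {C : Set R}
    (hconv : Convex ℝ C) (hclosed : IsClosed C) (hne : C.Nonempty) {J : Submodule ℝ R}
    (hJ : IsClosed (J : Set R)) (h : ∀ f ∈ C, ∃ t₀ : ℝ≥0, ∀ t, t₀ ≤ t → S t f ∈ J) :
    ∃ t₀ : ℝ≥0, ∀ f ∈ C, ∀ t, t₀ ≤ t → S t f ∈ J := by
  -- The subspaces grow with the time, so integer times suffice and the cover is countable.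
  obtain ⟨n, hn⟩ := hconv.exists_subset_of_subset_iUnion_submodule hclosed hne
    (fun n : ℕ => eventualPreimage S J n) (fun n => isClosed_eventualPreimage S hJ n)
    (fun f hf => by
      obtain ⟨t₀, ht₀⟩ := h f hf
      obtain ⟨n, hn⟩ := exists_nat_ge t₀
      exact ⟨n, mem_eventualPreimage.2 fun t ht => ht₀ t (hn.trans ht)⟩)
  exact ⟨n, fun f hf => mem_eventualPreimage.1 (hn hf)⟩

variable [Lattice R] [IsOrderedAddMonoid R] [IsOrderedModule ℝ R] [HasSolidNorm R]
  [CompleteSpace R]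

/-- The only closed order ideals which are uniformly eventually invariant are the trivial ones. -/
def IsPersistentlyIrreducibleFamily (S : ℝ≥0 → R →L[ℝ] R) : Prop :=
  ∀ J : Submodule ℝ R, IsOrderIdeal J → IsClosed (J : Set R) →
    (∃ t₀ : ℝ≥0, ∀ t, t₀ ≤ t → ∀ f ∈ J, S t f ∈ J) → J = ⊥ ∨ J = ⊤

/-- An invariant positive non-zero functional is strictly positive. -/
theorem eq_zero_of_invariant_functional_eq_zero {S : ℝ≥0 → R →L[ℝ] R}
    (hpos : ∀ f, 0 ≤ f → ∃ t₀ : ℝ≥0, ∀ t, t₀ ≤ t → 0 ≤ S t f)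
    (hirr : IsPersistentlyIrreducibleFamily S) {φ : StrongDual ℝ R}
    (hφ : ∀ f, 0 ≤ f → 0 ≤ φ f) (hφ0 : φ ≠ 0) (hφS : ∀ t f, φ (S t f) = φ f) {f : R}
    (hf : 0 ≤ f) (hφf : φ f = 0) : f = 0 := by
  -- Once `S t g ≥ 0`, the modulus in the null ideal disappears and invariance of `φ` applies.
  have hkey : ∀ g, 0 ≤ g → g ∈ nullIdeal φ hφ →
      ∃ t₀ : ℝ≥0, ∀ t, t₀ ≤ t → S t g ∈ nullIdeal φ hφ := by
    intro g hg hgJ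
    obtain ⟨t₀, ht₀⟩ := hpos g hg
    refine ⟨t₀, fun t ht => ?_⟩
    change φ |S t g| = 0
    have hgJ : φ |g| = 0 := hgJ
    rwa [abs_of_nonneg (ht₀ t ht), hφS, ← abs_of_nonneg hg]
  obtain ⟨t₀, ht₀⟩ := exists_uniform_time S (nullIdeal φ hφ).convex (isClosed_nullIdeal φ hφ)
    ⟨0, zero_mem _⟩ (isClosed_nullIdeal φ hφ) (fun g hg => by
      obtain ⟨t₁, h₁⟩ := hkey g⁺ (posPart_nonneg g) (isOrderIdeal_nullIdeal φ hφ _ g (by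
        rw [abs_of_nonneg (posPart_nonneg g), ← posPart_add_negPart]
        exact le_add_of_nonneg_right (negPart_nonneg g)) hg)
      obtain ⟨t₂, h₂⟩ := hkey g⁻ (negPart_nonneg g) (isOrderIdeal_nullIdeal φ hφ _ g (by
        rw [abs_of_nonneg (negPart_nonneg g), ← posPart_add_negPart]
        exact le_add_of_nonneg_left (posPart_nonneg g)) hg)
      refine ⟨max t₁ t₂, fun t ht => ?_⟩
      rw [← posPart_sub_negPart g, map_sub]
      exact sub_mem (h₁ t ((le_max_left _ _).trans ht)) (h₂ t ((le_max_right _ _).trans ht)))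
  rcases hirr _ (isOrderIdeal_nullIdeal φ hφ) (isClosed_nullIdeal φ hφ)
    ⟨t₀, fun t ht g hg => ht₀ g hg t ht⟩ with h | h
  · have : f ∈ nullIdeal φ hφ := by
      change φ |f| = 0
      rwa [abs_of_nonneg hf]
    rwa [h, Submodule.mem_bot] at this
  · refine absurd ?_ hφ0
    have hz : ∀ g, 0 ≤ g → φ g = 0 := fun g hg => by
      have : g ∈ nullIdeal φ hφ := h ▸ Submodule.mem_top
      have : φ |g| = 0 := this
      rwa [abs_of_nonneg hg] at this
    ext g
    rw [← posPart_sub_negPart g, map_sub, hz _ (posPart_nonneg g), hz _ (negPart_nonneg g)]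
    simp

/-- A positive non-zero fixed vector is a quasi-interior point. -/
theorem topologicalClosure_principalOrderIdeal_eq_top {S : ℝ≥0 → R →L[ℝ] R}
    (hpos : ∀ f, 0 ≤ f → ∃ t₀ : ℝ≥0, ∀ t, t₀ ≤ t → 0 ≤ S t f)
    (hirr : IsPersistentlyIrreducibleFamily S) {v : R} (hv : 0 ≤ v) (hv0 : v ≠ 0)
    (hSv : ∀ t, S t v = v) : (principalOrderIdeal v hv).topologicalClosure = ⊤ := by
  set J := (principalOrderIdeal v hv).topologicalClosure with hJ
  have hJc : IsClosed (J : Set R) := Submodule.isClosed_topologicalClosure _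
  -- Baire is run on the order interval, whose elements each eventually return to it; elements of
  -- the closure `J` need not be dominated by a multiple of `v`. Scaling and continuity then carry
  -- the uniform time over to `J`.
  obtain ⟨t₀, ht₀⟩ := exists_uniform_time S (C := Set.Icc (-v) v) (convex_Icc _ _) isClosed_Icc
    ⟨0, neg_nonpos.2 hv, hv⟩ hJc (fun f hf => by
      obtain ⟨t₁, h₁⟩ := hpos (v - f) (sub_nonneg.2 hf.2)
      obtain ⟨t₂, h₂⟩ := hpos (v + f) (neg_le_iff_add_nonneg'.1 hf.1)
      refine ⟨max t₁ t₂, fun t ht => Submodule.le_topologicalClosure _ ⟨1, one_pos, ?_⟩⟩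
      have h₁ := h₁ t ((le_max_left _ _).trans ht)
      have h₂ := h₂ t ((le_max_right _ _).trans ht)
      rw [map_sub, hSv, sub_nonneg] at h₁
      rw [map_add, hSv, ← neg_le_iff_add_nonneg'] at h₂
      rw [one_smul]
      exact abs_le'.2 ⟨h₁, neg_le.1 h₂⟩)
  have hinv : ∀ t, t₀ ≤ t → ∀ f ∈ J, S t f ∈ J := by
    intro t ht f hf
    have := map_mem_closure (S t).continuous (t := (J : Set R)) hf ?_
    · rwa [hJc.closure_eq] at this
    · rintro g ⟨c, hc, hg⟩
      have hg' := abs_le'.1 hg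
      have hmem : c⁻¹ • g ∈ Set.Icc (-v) v := by
        refine ⟨?_, (inv_smul_le_iff_of_pos hc).2 hg'.1⟩
        rw [neg_le, ← smul_neg]
        exact (inv_smul_le_iff_of_pos hc).2 hg'.2
      have := ht₀ _ hmem t ht
      rw [map_smul] at this
      exact (J.smul_mem_iff (inv_ne_zero hc.ne')).1 this
  rcases hirr J (isOrderIdeal_principalOrderIdeal v hv).topologicalClosure hJc
    ⟨t₀, hinv⟩ with h | h
  · refine absurd ?_ hv0
    have : v ∈ J := Submodule.le_topologicalClosure _ (self_mem_principalOrderIdeal v hv)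
    rwa [h, Submodule.mem_bot] at this
  · exact h

omit [IsOrderedModule ℝ R] [HasSolidNorm R] [CompleteSpace R] in
/-- The fixed space of an individually eventually positive semigroup with a strictly positive
invariant functional is closed under the modulus. -/
theorem abs_fixed_of_fixed {S : ℝ≥0 → R →L[ℝ] R} (hadd : ∀ s t f, S (s + t) f = S s (S t f))
    (hpos : ∀ f, 0 ≤ f → ∃ t₀ : ℝ≥0, ∀ t, t₀ ≤ t → 0 ≤ S t f) {φ : StrongDual ℝ R}
    (hφ0 : ∀ f, 0 ≤ f → φ f = 0 → f = 0) (hφS : ∀ t f, φ (S t f) = φ f) {u : R}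
    (hu : ∀ t, S t u = u) (s : ℝ≥0) : S s |u| = |u| := by
  obtain ⟨t₁, h₁⟩ := hpos (|u| - u) (sub_nonneg.2 (le_abs_self u))
  obtain ⟨t₂, h₂⟩ := hpos (|u| + u) (neg_le_iff_add_nonneg.1 (neg_le_abs u))
  have hfix : ∀ t, max t₁ t₂ ≤ t → S t |u| = |u| := by
    intro t ht
    have h₁ := h₁ t ((le_max_left _ _).trans ht)
    have h₂ := h₂ t ((le_max_right _ _).trans ht)
    rw [map_sub, hu, sub_nonneg] at h₁
    rw [map_add, hu, ← neg_le_iff_add_nonneg] at h₂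
    exact sub_eq_zero.1 (hφ0 _ (sub_nonneg.2 (abs_le'.2 ⟨h₁, h₂⟩)) (by
      rw [map_sub, hφS, sub_self]))
  -- Small times `s` are handled by first moving `|u|` to a time from which it is known to be fixed.
  calc S s |u| = S s (S (max t₁ t₂) |u|) := by rw [hfix _ le_rfl]
    _ = |u| := by rw [← hadd, hfix _ le_add_self]

/-- The fixed space of a persistently irreducible, individually eventually positive semigroup with
a positive non-zero invariant functional is spanned by a quasi-interior point as soon as it is
non-zero. -/
theorem exists_quasiInterior_fixed {S : ℝ≥0 → R →L[ℝ] R}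
    (hadd : ∀ s t f, S (s + t) f = S s (S t f))
    (hpos : ∀ f, 0 ≤ f → ∃ t₀ : ℝ≥0, ∀ t, t₀ ≤ t → 0 ≤ S t f)
    (hirr : IsPersistentlyIrreducibleFamily S) {φ : StrongDual ℝ R}
    (hφ0 : ∀ f, 0 ≤ f → φ f = 0 → f = 0) (hφS : ∀ t f, φ (S t f) = φ f) {u : R} (hu0 : u ≠ 0)
    (hu : ∀ t, S t u = u) :
    ∃ (v : R) (hv : 0 ≤ v), v ≠ 0 ∧ (∀ t, S t v = v) ∧
      (principalOrderIdeal v hv).topologicalClosure = ⊤ ∧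
      ∀ w, (∀ t, S t w = w) → ∃ c : ℝ, w = c • v := by
  have habs : ∀ w, (∀ t, S t w = w) → ∀ t, S t |w| = |w| := fun w hw =>
    abs_fixed_of_fixed hadd hpos hφ0 hφS hw
  have htwo : ∀ w : R, (2 : ℝ) • w⁺ = |w| + w := fun w => by
    have h := posPart_sub_negPart w
    rw [two_smul, ← posPart_add_negPart w, ← sub_eq_iff_eq_add'.2 (sub_eq_iff_eq_add.1 h)]
    abel
  have hposPart : ∀ w, (∀ t, S t w = w) → ∀ t, S t w⁺ = w⁺ := fun w hw t => by
    have : (2 : ℝ) • S t w⁺ = (2 : ℝ) • w⁺ := by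
      rw [← map_smul, htwo, map_add, habs w hw, hw]
    exact (smul_right_injective R two_ne_zero) this
  have hnegPart : ∀ w, (∀ t, S t w = w) → ∀ t, S t w⁻ = w⁻ := fun w hw t => by
    rw [← posPart_neg]
    exact hposPart (-w) (fun t => by rw [map_neg, hw]) t
  have hv0 : |u| ≠ 0 := fun h => hu0 (norm_eq_zero.1 (by rw [← norm_abs_eq_norm, h, norm_zero]))
  refine ⟨|u|, abs_nonneg u, hv0, habs u hu,
    topologicalClosure_principalOrderIdeal_eq_top hpos hirr (abs_nonneg u) hv0 (habs u hu), ?_⟩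
  intro w hw
  have hφu : φ |u| ≠ 0 := fun h => hv0 (hφ0 _ (abs_nonneg u) h)
  refine ⟨φ w / φ |u|, ?_⟩
  -- The coefficient is chosen so that `φ z = 0`; it remains to see that `z` vanishes.
  set z := w - (φ w / φ |u|) • |u| with hz
  have hzS : ∀ t, S t z = z := fun t => by rw [hz, map_sub, map_smul, hw, habs u hu]
  have hφz : φ z = 0 := by
    rw [hz, map_sub, map_smul, smul_eq_mul, div_mul_cancel₀ _ hφu, sub_self]
  have hφpn : φ z⁺ = φ z⁻ := by
    rw [← sub_eq_zero, ← map_sub, posPart_sub_negPart, hφz]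
  -- A non-zero `z⁺` is a fixed quasi-interior point, so the disjoint element `z⁻` is zero and `φ z⁺
  -- = φ z⁻ = 0`.
  have hp : z⁺ = 0 := by
    by_contra hne
    have := eq_zero_of_disjoint_of_topologicalClosure_eq_top (posPart_nonneg z)
      (negPart_nonneg z) (topologicalClosure_principalOrderIdeal_eq_top hpos hirr
        (posPart_nonneg z) hne (hposPart z hzS)) (posPart_inf_negPart_eq_zero z)
    rw [this, map_zero] at hφpn
    exact hne (hφ0 _ (posPart_nonneg z) hφpn)
  have hn : z⁻ = 0 := by
    rw [hp, map_zero] at hφpn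
    exact hφ0 _ (negPart_nonneg z) hφpn.symm
  have : z = 0 := by rw [← posPart_sub_negPart z, hp, hn, sub_zero]
  exact sub_eq_zero.1 this

end RealSemigroup

/-! ### Eigenspaces and generalized eigenspaces -/

namespace UnboundedOperator

variable {X : Type*} [AddCommGroup X] [Module ℂ X]

theorem mem_eigenspace_iff_mem_graph (A : X →ₗ.[ℂ] X) (μ : ℂ) (x : X) :
    x ∈ eigenspace A μ ↔ (x, μ • x) ∈ A.graph := by
  rw [mem_eigenspace, LinearPMap.mem_graph_iff]
  constructor
  · rintro ⟨h, hx⟩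
    exact ⟨⟨x, h⟩, rfl, hx⟩
  · rintro ⟨⟨y, hy⟩, rfl, h⟩
    exact ⟨hy, h⟩

theorem kerPow_one (A : X →ₗ.[ℂ] X) (μ : ℂ) : kerPow A μ 1 = eigenspace A μ := by
  ext x
  rw [mem_kerPow_succ, mem_eigenspace]
  refine exists_congr fun h => ?_
  rw [kerPow, Submodule.mem_bot, sub_eq_zero, eq_comm]

/-- If `(μ - A) x ∈ ker (μ - A)` implies `(μ - A) x = 0`, then the generalized eigenspace is the
eigenspace. -/
theorem generalizedEigenspace_eq_eigenspace (A : X →ₗ.[ℂ] X) (μ : ℂ)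
    (h : ∀ x : A.domain, μ • (x : X) - A x ∈ eigenspace A μ → μ • (x : X) - A x = 0) :
    generalizedEigenspace A μ = eigenspace A μ := by
  have hle : ∀ n, kerPow A μ n ≤ eigenspace A μ := by
    intro n
    induction n with
    | zero => exact bot_le
    | succ n ih =>
      intro x hx
      obtain ⟨hxA, hx⟩ := (mem_kerPow_succ A μ n x).1 hx
      exact (mem_eigenspace A μ x).2 ⟨hxA, (sub_eq_zero.1 (h ⟨x, hxA⟩ (ih hx))).symm⟩
  refine le_antisymm (fun x hx => ?_) fun x hx => ?_
  · obtain ⟨n, hn⟩ := Set.mem_iUnion.1 hx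
    exact hle n hn
  · rw [← kerPow_one] at hx
    exact Set.mem_iUnion.2 ⟨1, hx⟩

end UnboundedOperator

/-! ### Generators, orbits and eigenvectors -/

namespace C0Semigroup

open UnboundedOperator

variable {E : Type*} [NormedAddCommGroup E] [NormedSpace ℂ E] (T : C0Semigroup E)

/-- The orbit of `x`, as a function on the real line which is constant on the negative half-line. -/
def orbit (x : E) (t : ℝ) : E := T.op t.toNNReal x

theorem continuous_orbit (x : E) : Continuous (T.orbit x) :=
  (T.continuous_op x).comp continuous_real_toNNReal

theorem orbit_zero (x : E) : T.orbit x 0 = x := by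
  simp [orbit, T.op_zero]

theorem orbit_coe (x : E) (t : ℝ≥0) : T.orbit x t = T.op t x := by
  simp [orbit]

theorem orbit_add (x : E) {s t : ℝ} (hs : 0 ≤ s) (ht : 0 ≤ t) :
    T.orbit x (s + t) = T.op s.toNNReal (T.orbit x t) := by
  rw [orbit, Real.toNNReal_add hs ht, T.op_add]
  rfl

theorem mem_generatorGraph_iff {x y : E} : (x, y) ∈ T.generatorGraph ↔
    HasDerivWithinAt (T.orbit x) y (Set.Ici 0) 0 := by
  have hmap : map ((↑) : ℝ≥0 → ℝ) (𝓝[>] 0) = 𝓝[>] 0 := by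
    rw [NNReal.isEmbedding_coe.map_nhdsWithin_eq]
    congr 1
    ext r
    constructor
    · rintro ⟨t, ht, rfl⟩
      exact NNReal.coe_pos.2 ht
    · intro hr
      exact ⟨⟨r, le_of_lt hr⟩, hr, rfl⟩
  rw [← hasDerivWithinAt_Ioi_iff_Ici, hasDerivWithinAt_iff_tendsto_slope' (by simp), ← hmap,
    tendsto_map'_iff]
  change Tendsto _ _ _ ↔ _
  refine tendsto_congr fun t => ?_
  simp [slope_def_module, orbit, T.op_zero]

theorem op_mem_generatorGraph {x y : E} (h : (x, y) ∈ T.generatorGraph) (s : ℝ≥0) :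
    (T.op s x, T.op s y) ∈ T.generatorGraph := by
  have h' : Tendsto (fun t : ℝ≥0 => (t : ℝ)⁻¹ • (T.op t x - x)) (𝓝[>] 0) (𝓝 y) := h
  refine (((T.op s).continuous.tendsto y).comp h').congr fun t => ?_
  have hcomm : T.op s (T.op t x) = T.op t (T.op s x) := by
    rw [← ContinuousLinearMap.comp_apply, ← T.op_add, add_comm, T.op_add]
    rfl
  simp [hcomm]

/-- The semigroup law carries the right derivative at `0` to time `s`. One-sided derivatives suffice
for the differential equation below. -/
theorem hasDerivWithinAt_orbit {x y : E} (h : (x, y) ∈ T.generatorGraph) {s : ℝ} (hs : 0 ≤ s) :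
    HasDerivWithinAt (T.orbit x) (T.orbit y s) (Set.Ici s) s := by
  have h0 := T.mem_generatorGraph_iff.1 h
  have h1 : HasDerivWithinAt (fun t => T.orbit x (t - s)) y (Set.Ici s) s := by
    have := HasDerivWithinAt.scomp_of_eq (h := fun t : ℝ => t - s) (h' := 1) s h0
      ((hasDerivWithinAt_id s (Set.Ici s)).sub_const s)
      (fun t ht => Set.mem_Ici.2 (sub_nonneg.2 (Set.mem_Ici.1 ht))) (sub_self s).symm
    rwa [one_smul] at this
  have h2 : HasDerivWithinAt (fun t => T.op s.toNNReal (T.orbit x (t - s))) (T.op s.toNNReal y)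
      (Set.Ici s) s :=
    ((T.op s.toNNReal).restrictScalars ℝ).hasFDerivAt.comp_hasDerivWithinAt s h1
  refine h2.congr (fun t ht => ?_) ?_
  · rw [← T.orbit_add x hs (sub_nonneg.2 ht), add_sub_cancel]
  · rw [← T.orbit_add x hs (sub_self s).ge, add_sub_cancel]

/-- The continuous function `e^{-μ s} f s` has vanishing right derivative, hence is constant. -/
theorem eq_exp_smul_of_hasDerivWithinAt {F : Type*} [NormedAddCommGroup F] [NormedSpace ℝ F]
    {f : ℝ → F} (hf : Continuous f) {μ : ℝ}
    (h : ∀ s, 0 ≤ s → HasDerivWithinAt f (μ • f s) (Set.Ici s) s) {t : ℝ} (ht : 0 ≤ t) :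
    f t = Real.exp (μ * t) • f 0 := by
  have hexp : ∀ s, HasDerivAt (fun s => Real.exp (-(μ * s))) (-(μ * Real.exp (-(μ * s)))) s := by
    intro s
    have := (((hasDerivAt_id s).const_mul μ).neg).exp
    simpa [mul_comm] using this
  have := constant_of_has_deriv_right_zero (f := fun s => Real.exp (-(μ * s)) • f s) (a := 0)
    (b := t) (by fun_prop) (fun s hs => by
      have := (hexp s).hasDerivWithinAt.smul (h s hs.1)
      refine this.congr_deriv ?_
      rw [smul_smul, neg_smul, mul_comm, add_neg_cancel]) t ⟨ht, le_rfl⟩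
  simp only [mul_zero, neg_zero, Real.exp_zero, one_smul] at this
  rw [← this, smul_smul, ← Real.exp_add, add_neg_cancel, Real.exp_zero, one_smul]

/-- The eigenvectors of the generator are the eigenvectors of the semigroup. -/
theorem mem_eigenspace_generator_iff {μ : ℝ} {x : E} :
    x ∈ eigenspace T.generator (μ : ℂ) ↔ ∀ t : ℝ≥0, T.op t x = Real.exp (μ * t) • x := by
  rw [mem_eigenspace_iff_mem_graph, generator_graph, Complex.coe_smul]
  constructor
  · intro h t
    have := eq_exp_smul_of_hasDerivWithinAt (T.continuous_orbit x) (μ := μ)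
      (fun s hs => by
        convert T.hasDerivWithinAt_orbit h hs using 1
        rw [orbit, orbit, ← Complex.coe_smul, ← Complex.coe_smul, map_smul]) t.2
    rwa [T.orbit_zero, NNReal.val_eq_coe, T.orbit_coe] at this
  · intro h
    rw [T.mem_generatorGraph_iff]
    have h1 : HasDerivAt (fun t : ℝ => Real.exp (μ * t) • x) (μ • x) 0 := by
      have := (((hasDerivAt_id (0 : ℝ)).const_mul μ).exp).smul_const x
      simpa using this
    refine h1.hasDerivWithinAt.congr (fun t ht => ?_) ?_
    · have := h t.toNNReal
      rwa [Real.coe_toNNReal t ht] at this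
    · rw [T.orbit_zero]
      simp

variable [CompleteSpace E]

/-- Applying `T t` shifts the integral to the interval from `t` to `t + h`; the right derivative at
`t = 0` is the difference of the integrand at the endpoints. -/
theorem integral_orbit_mem_generatorGraph (x : E) {h : ℝ} (hh : 0 ≤ h) :
    (∫ s in (0 : ℝ)..h, T.orbit x s, T.orbit x h - x) ∈ T.generatorGraph := by
  rw [T.mem_generatorGraph_iff]
  have hc := T.continuous_orbit x
  have hi : ∀ a b : ℝ, IntervalIntegrable (T.orbit x) MeasureTheory.volume a b :=
    fun a b => hc.intervalIntegrable a b
  have h0 : ∀ a : ℝ, HasDerivAt (fun t => ∫ s in (0 : ℝ)..t, T.orbit x s) (T.orbit x a) a :=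
    fun a => intervalIntegral.integral_hasDerivAt_right (hi 0 a)
      hc.aestronglyMeasurable.stronglyMeasurableAtFilter hc.continuousAt
  have h1 : HasDerivAt (fun t => (∫ s in (0 : ℝ)..(t + h), T.orbit x s) -
      ∫ s in (0 : ℝ)..t, T.orbit x s) (T.orbit x h - x) 0 := by
    have h2 := (h0 (0 + h)).comp_add_const 0 h
    have h3 := h2.sub (h0 0)
    rwa [zero_add, T.orbit_zero] at h3
  have key : ∀ t : ℝ, 0 ≤ t → T.orbit (∫ s in (0 : ℝ)..h, T.orbit x s) t =
      (∫ s in (0 : ℝ)..(t + h), T.orbit x s) - ∫ s in (0 : ℝ)..t, T.orbit x s := by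
    intro t ht
    rw [intervalIntegral.integral_interval_sub_left (hi _ _) (hi _ _), orbit,
      ← ContinuousLinearMap.intervalIntegral_comp_comm _ (hi _ _)]
    have : ∫ s in (0 : ℝ)..h, T.orbit x (t + s) = ∫ s in t..(t + h), T.orbit x s := by
      simp
    rw [← this]
    refine intervalIntegral.integral_congr fun s hs => ?_
    rw [Set.uIcc_of_le hh] at hs
    exact (T.orbit_add x ht hs.1).symm
  exact h1.hasDerivWithinAt.congr (fun t ht => key t ht) (key 0 le_rfl)

/-- The generator of a `C₀`-semigroup is densely defined. -/
theorem dense_generator_domain : Dense (T.generator.domain : Set E) := by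
  intro x
  have hc := T.continuous_orbit x
  have h0 : HasDerivAt (fun t => ∫ s in (0 : ℝ)..t, T.orbit x s) (T.orbit x 0) 0 :=
    intervalIntegral.integral_hasDerivAt_right (hc.intervalIntegrable 0 0)
      hc.aestronglyMeasurable.stronglyMeasurableAtFilter hc.continuousAt
  -- The averages of the orbit over `[0, h]` lie in the domain and tend to `x`.
  have h1 := (hasDerivWithinAt_iff_tendsto_slope' (s := Set.Ioi 0) (by simp)).1
    (h0.hasDerivWithinAt)
  rw [T.orbit_zero] at h1
  refine mem_closure_of_tendsto h1 ?_
  filter_upwards [self_mem_nhdsWithin] with h hh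
  have hmem : (∫ s in (0 : ℝ)..h, T.orbit x s) ∈ T.generator.domain := by
    have := T.integral_orbit_mem_generatorGraph x (le_of_lt hh)
    rw [← generator_graph] at this
    exact LinearPMap.mem_domain_of_mem_graph this
  simp only [slope_def_module, intervalIntegral.integral_same, sub_zero]
  rw [← Complex.coe_smul]
  exact Submodule.smul_mem _ _ hmem

theorem eigenspace_dual_apply {μ : ℝ} {φ : StrongDual ℂ E}
    (hφ : φ ∈ eigenspace (dual T.generator) (μ : ℂ)) (x : T.generator.domain) :
    φ (T.generator x) = μ * φ x := by
  rw [mem_eigenspace_iff_mem_graph, dual_graph _ T.dense_generator_domain] at hφ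
  exact hφ x

/-- The eigenvectors of the dual of the generator are eigenvectors of the dual semigroup. -/
theorem eigenspace_dual_op {μ : ℝ} {φ : StrongDual ℂ E}
    (hφ : φ ∈ eigenspace (dual T.generator) (μ : ℂ)) (t : ℝ≥0) (x : E) :
    φ (T.op t x) = Real.exp (μ * t) • φ x := by
  have hφ' : ∀ x y, (x, y) ∈ T.generatorGraph → φ y = μ • φ x := by
    intro x y h
    rw [← generator_graph, LinearPMap.mem_graph_iff] at h
    obtain ⟨z, rfl, rfl⟩ := h
    rw [T.eigenspace_dual_apply hφ, Complex.real_smul]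
  -- On the domain, `φ` along the orbit solves the scalar equation `y' = μ y`; density of the domain
  -- does the rest.
  have heq : Set.EqOn (fun x => φ (T.op t x)) (fun x => Real.exp (μ * t) • φ x)
      (T.generator.domain : Set E) := by
    intro x hx
    have hmem := LinearPMap.mem_graph T.generator ⟨x, hx⟩
    rw [generator_graph] at hmem
    have := eq_exp_smul_of_hasDerivWithinAt (φ.continuous.comp (T.continuous_orbit x)) (μ := μ)
      (fun s hs => by
        have := (φ.restrictScalars ℝ).hasFDerivAt.comp_hasDerivWithinAt s
          (T.hasDerivWithinAt_orbit hmem hs)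
        exact this.congr_deriv (hφ' _ _ (T.op_mem_generatorGraph hmem _))) t.2
    simpa [T.orbit_zero, T.orbit_coe] using this
  have := Continuous.ext_on T.dense_generator_domain (by fun_prop) (by fun_prop) heq
  exact congrFun this x

end C0Semigroup

/-! ### Passage between a complex Banach lattice and its real part -/

namespace ComplexBanachLattice

variable {E : Type*} [NormedAddCommGroup E] [NormedSpace ℂ E] [ComplexBanachLattice E]

/-- The real part of an element of a complex Banach lattice. -/
noncomputable def rePart (z : E) : realPart (E := E) := (existsUnique_re_im z).choose.1

/-- The imaginary part of an element of a complex Banach lattice. -/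
noncomputable def imPart (z : E) : realPart (E := E) := (existsUnique_re_im z).choose.2

theorem rePart_add_I_smul_imPart (z : E) :
    (rePart z : E) + Complex.I • (imPart z : E) = z :=
  (existsUnique_re_im z).choose_spec.1.symm

theorem rePart_imPart_eq {z : E} {x y : realPart (E := E)}
    (h : z = (x : E) + Complex.I • (y : E)) : rePart z = x ∧ imPart z = y := by
  have := (existsUnique_re_im z).choose_spec.2 (x, y) h
  exact ⟨congrArg Prod.fst this.symm, congrArg Prod.snd this.symm⟩

theorem rePart_mk (x y : realPart (E := E)) : rePart ((x : E) + Complex.I • (y : E)) = x :=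
  (rePart_imPart_eq rfl).1

theorem imPart_mk (x y : realPart (E := E)) : imPart ((x : E) + Complex.I • (y : E)) = y :=
  (rePart_imPart_eq rfl).2

theorem rePart_coe (x : realPart (E := E)) : rePart (x : E) = x :=
  (rePart_imPart_eq (x := x) (y := 0) (by simp)).1

theorem imPart_coe (x : realPart (E := E)) : imPart (x : E) = 0 :=
  (rePart_imPart_eq (x := x) (y := 0) (by simp)).2

theorem rePart_imPart_add (z w : E) :
    rePart (z + w) = rePart z + rePart w ∧ imPart (z + w) = imPart z + imPart w := by
  refine rePart_imPart_eq ?_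
  nth_rw 1 [← rePart_add_I_smul_imPart z, ← rePart_add_I_smul_imPart w]
  push_cast
  module

theorem rePart_imPart_smul (c : ℂ) (z : E) :
    rePart (c • z) = c.re • rePart z - c.im • imPart z ∧
      imPart (c • z) = c.re • imPart z + c.im • rePart z := by
  refine rePart_imPart_eq ?_
  nth_rw 1 [← rePart_add_I_smul_imPart z, ← Complex.re_add_im c]
  push_cast
  simp only [← Complex.coe_smul]
  have : Complex.I * Complex.I = -1 := Complex.I_mul_I
  match_scalars
  · ring
  · linear_combination (c.im : ℂ) * this

theorem isLUB_modulus_rePart_imPart (z : E) :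
    IsLUB (Set.range fun θ : ℝ => Real.cos θ • rePart z + Real.sin θ • imPart z) (modulus z) := by
  have := isLUB_modulus (rePart z) (imPart z)
  rwa [rePart_add_I_smul_imPart] at this

theorem abs_rePart_le_modulus (z : E) : |rePart z| ≤ modulus z := by
  have h := (isLUB_modulus_rePart_imPart z).1
  refine abs_le'.2 ⟨?_, ?_⟩
  · simpa using h (Set.mem_range_self 0)
  · simpa using h (Set.mem_range_self Real.pi)

theorem abs_imPart_le_modulus (z : E) : |imPart z| ≤ modulus z := by
  have h := (isLUB_modulus_rePart_imPart z).1
  refine abs_le'.2 ⟨?_, ?_⟩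
  · simpa using h (Set.mem_range_self (Real.pi / 2))
  · simpa using h (Set.mem_range_self (-(Real.pi / 2)))

theorem smul_le_abs_of_abs_le_one {c : ℝ} (hc : |c| ≤ 1) (x : realPart (E := E)) :
    c • x ≤ |x| := by
  refine (le_abs_self _).trans ((abs_smul_le_smul_abs_of_vectorLattice c x).trans ?_)
  simpa using smul_le_smul_of_nonneg_right hc (abs_nonneg x)

theorem modulus_le_abs_add_abs (z : E) : modulus z ≤ |rePart z| + |imPart z| := by
  refine (isLUB_modulus_rePart_imPart z).2 ?_
  rintro _ ⟨θ, rfl⟩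
  exact add_le_add (smul_le_abs_of_abs_le_one (Real.abs_cos_le_one θ) _)
    (smul_le_abs_of_abs_le_one (Real.abs_sin_le_one θ) _)

/-- Solidity of the norm makes the real and imaginary part contractive. -/
theorem norm_le_of_abs_le_modulus {x : realPart (E := E)} {z : E} (h : |x| ≤ modulus z) :
    ‖x‖ ≤ ‖z‖ := by
  rw [← norm_modulus z]
  exact norm_le_norm_of_abs_le_abs (h.trans (le_abs_self _))

/-- The projection onto the real part along `i` times the real part. -/
noncomputable def reCLM : E →L[ℝ] realPart (E := E) :=
  LinearMap.mkContinuous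
    { toFun := rePart
      map_add' := fun z w => (rePart_imPart_add z w).1
      map_smul' := fun c z => by simpa using (rePart_imPart_smul (c : ℂ) z).1 } 1
    fun z => by simpa using norm_le_of_abs_le_modulus (abs_rePart_le_modulus z)

/-- The imaginary part as a bounded real-linear operator. -/
noncomputable def imCLM : E →L[ℝ] realPart (E := E) :=
  LinearMap.mkContinuous
    { toFun := imPart
      map_add' := fun z w => (rePart_imPart_add z w).2
      map_smul' := fun c z => by simpa using (rePart_imPart_smul (c : ℂ) z).2 } 1
    fun z => by simpa using norm_le_of_abs_le_modulus (abs_imPart_le_modulus z)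

theorem continuous_rePart : Continuous (rePart : E → realPart (E := E)) := reCLM.continuous

theorem continuous_imPart : Continuous (imPart : E → realPart (E := E)) := imCLM.continuous

theorem isClosed_realPart : IsClosed (realPart (E := E) : Set E) := by
  have : (realPart (E := E) : Set E) = {z | (rePart z : E) = z} := by
    ext z
    exact ⟨fun hz => congrArg Subtype.val (rePart_coe ⟨z, hz⟩), fun hz => hz ▸ (rePart z).2⟩
  rw [this]
  exact isClosed_eq (continuous_subtype_val.comp continuous_rePart) continuous_id

instance [CompleteSpace E] : CompleteSpace (realPart (E := E)) :=
  isClosed_realPart.completeSpace_coe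

/-- The complexification of a real subspace. -/
def complexify (J : Submodule ℝ (realPart (E := E))) : Submodule ℂ E where
  carrier := {z | rePart z ∈ J ∧ imPart z ∈ J}
  zero_mem' := by
    have h1 := rePart_coe (0 : realPart (E := E))
    have h2 := imPart_coe (0 : realPart (E := E))
    rw [Submodule.coe_zero] at h1 h2
    simp [h1, h2]
  add_mem' := by
    rintro z w ⟨hz, hz'⟩ ⟨hw, hw'⟩
    have h := rePart_imPart_add z w
    exact ⟨h.1 ▸ add_mem hz hw, h.2 ▸ add_mem hz' hw'⟩
  smul_mem' := by
    rintro c z ⟨hz, hz'⟩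
    have h := rePart_imPart_smul c z
    exact ⟨h.1 ▸ sub_mem (J.smul_mem _ hz) (J.smul_mem _ hz'),
      h.2 ▸ add_mem (J.smul_mem _ hz') (J.smul_mem _ hz)⟩

theorem mem_complexify {J : Submodule ℝ (realPart (E := E))} {z : E} :
    z ∈ complexify J ↔ rePart z ∈ J ∧ imPart z ∈ J := Iff.rfl

theorem coe_mem_complexify {J : Submodule ℝ (realPart (E := E))} {x : realPart (E := E)} :
    (x : E) ∈ complexify J ↔ x ∈ J := by
  rw [mem_complexify, rePart_coe, imPart_coe]
  exact and_iff_left (zero_mem J)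

theorem isClosed_complexify {J : Submodule ℝ (realPart (E := E))}
    (hJ : IsClosed (J : Set (realPart (E := E)))) : IsClosed (complexify J : Set E) :=
  (hJ.preimage continuous_rePart).inter (hJ.preimage continuous_imPart)

/-- The real and imaginary parts of `f` are dominated by `modulus f ≤ modulus g`, which in turn is
at most `|rePart g| + |imPart g|`, an element of `J`. -/
theorem isIdeal_complexify {J : Submodule ℝ (realPart (E := E))} (hJ : IsOrderIdeal J) :
    IsIdeal (complexify J) := by
  rintro f g hfg ⟨hg, hg'⟩
  have hmem : |rePart g| + |imPart g| ∈ J :=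
    add_mem (hJ _ _ (abs_abs _).le hg) (hJ _ _ (abs_abs _).le hg')
  have hle : modulus f ≤ |(|rePart g| + |imPart g|)| :=
    hfg.trans ((modulus_le_abs_add_abs g).trans (le_abs_self _))
  exact ⟨hJ _ _ ((abs_rePart_le_modulus f).trans hle) hmem,
    hJ _ _ ((abs_imPart_le_modulus f).trans hle) hmem⟩

theorem isPositive_coe {x : realPart (E := E)} : IsPositive (x : E) ↔ 0 ≤ x :=
  ⟨fun ⟨_, h⟩ => h, fun h => ⟨x.2, h⟩⟩

/-- Quasi-interior points of the real part are quasi-interior points of the complexification. -/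
theorem isQuasiInterior_of_topologicalClosure_eq_top {v : realPart (E := E)} (hv : 0 ≤ v)
    (h : (principalOrderIdeal v hv).topologicalClosure = ⊤) : IsQuasiInterior v := by
  refine ⟨hv, fun z => ?_⟩
  have hmem : ∀ x : realPart (E := E), x ∈ closure (principalOrderIdeal v hv : Set _) :=
    fun x => (h ▸ Submodule.mem_top : x ∈ (principalOrderIdeal v hv).topologicalClosure)
  have hcont : Continuous fun p : realPart (E := E) × realPart (E := E) =>
      (p.1 : E) + Complex.I • (p.2 : E) := by fun_prop
  have := map_mem_closure₂ (f := fun x y : realPart (E := E) => (x : E) + Complex.I • (y : E))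
    (u := principalIdeal v) hcont (hmem (rePart z)) (hmem (imPart z)) ?_
  · rwa [rePart_add_I_smul_imPart] at this
  · rintro x ⟨a, ha, hx⟩ y ⟨b, hb, hy⟩
    refine ⟨a + b, add_pos ha hb, (modulus_le_abs_add_abs _).trans ?_⟩
    rw [rePart_mk, imPart_mk, add_smul]
    exact add_le_add hx hy

/-- The restriction of a real operator to the real part. -/
noncomputable def realRestrict (S : E →L[ℂ] E) : realPart (E := E) →L[ℝ] realPart (E := E) :=
  reCLM.comp ((S.restrictScalars ℝ).comp (realPart (E := E)).subtypeL)

theorem coe_realRestrict {S : E →L[ℂ] E} (hS : IsRealOperator S) (x : realPart (E := E)) :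
    (realRestrict S x : E) = S x :=
  congrArg Subtype.val (rePart_coe ⟨S x, hS x x.2⟩)

theorem map_eq_realRestrict {S : E →L[ℂ] E} (hS : IsRealOperator S) (z : E) :
    S z = (realRestrict S (rePart z) : E) + Complex.I • (realRestrict S (imPart z) : E) := by
  rw [coe_realRestrict hS, coe_realRestrict hS, ← map_smul, ← map_add, rePart_add_I_smul_imPart]

/-- The restriction of the real part of a functional to the real part of the space. -/
noncomputable def realFunctional (φ : StrongDual ℂ E) : StrongDual ℝ (realPart (E := E)) :=
  Complex.reCLM.comp ((φ.restrictScalars ℝ).comp (realPart (E := E)).subtypeL)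

/-- Every real element is a difference of positive ones, on which `φ` takes real values. -/
theorem coe_realFunctional {φ : StrongDual ℂ E} (hφ : IsPositiveFunctional φ)
    (x : realPart (E := E)) : ((realFunctional φ x : ℝ) : ℂ) = φ x := by
  have him : (φ x).im = 0 := by
    rw [← posPart_sub_negPart x, Submodule.coe_sub, map_sub, Complex.sub_im,
      (hφ _ (isPositive_coe.2 (posPart_nonneg x))).2,
      (hφ _ (isPositive_coe.2 (negPart_nonneg x))).2, sub_zero]
  exact Complex.ext rfl him.symm

theorem realFunctional_ne_zero {φ : StrongDual ℂ E} (hφ : IsPositiveFunctional φ) (h0 : φ ≠ 0) :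
    realFunctional φ ≠ 0 := by
  intro h
  refine h0 (ContinuousLinearMap.ext fun z => ?_)
  rw [← rePart_add_I_smul_imPart z, map_add, map_smul, ← coe_realFunctional hφ,
    ← coe_realFunctional hφ, h]
  simp

end ComplexBanachLattice

/-! ### The rescaled semigroup on the real part -/

namespace C0Semigroup

open ComplexBanachLattice UnboundedOperator

variable {E : Type*} [NormedAddCommGroup E] [NormedSpace ℂ E] [ComplexBanachLattice E]
  (T : C0Semigroup E)

/-- The rescaled semigroup `e^{-μ t} T t` on the real part. -/
noncomputable def rescaledReal (μ : ℝ) (t : ℝ≥0) : realPart (E := E) →L[ℝ] realPart (E := E) :=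
  Real.exp (-(μ * t)) • realRestrict (T.op t)

variable {T}

theorem coe_rescaledReal (hreal : T.IsReal) (μ : ℝ) (t : ℝ≥0) (x : realPart (E := E)) :
    (T.rescaledReal μ t x : E) = Real.exp (-(μ * t)) • T.op t x := by
  rw [← coe_realRestrict (hreal t)]
  rfl

theorem rescaledReal_add (hreal : T.IsReal) (μ : ℝ) (s t : ℝ≥0) (x : realPart (E := E)) :
    T.rescaledReal μ (s + t) x = T.rescaledReal μ s (T.rescaledReal μ t x) := by
  refine Subtype.ext ?_
  rw [coe_rescaledReal hreal, coe_rescaledReal hreal, coe_rescaledReal hreal, T.op_add,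
    ← Complex.coe_smul, ← Complex.coe_smul, ← Complex.coe_smul, map_smul, smul_smul,
    ← Complex.ofReal_mul, ← Real.exp_add, ContinuousLinearMap.comp_apply]
  congr 4
  push_cast
  ring

theorem rescaledReal_eventually_nonneg (hreal : T.IsReal)
    (hpos : T.IsIndividuallyEventuallyPositive) (μ : ℝ) (f : realPart (E := E)) (hf : 0 ≤ f) :
    ∃ t₀ : ℝ≥0, ∀ t, t₀ ≤ t → 0 ≤ T.rescaledReal μ t f := by
  obtain ⟨t₀, ht₀⟩ := hpos f (isPositive_coe.2 hf)
  refine ⟨t₀, fun t ht => smul_nonneg (Real.exp_nonneg _) ?_⟩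
  have := ht₀ t ht
  rwa [← coe_realRestrict (hreal t), isPositive_coe] at this

/-- A closed ideal of the real part complexifies to a closed ideal of `E`, and the non-zero factor
`e^{-μ t}` does not affect invariance. -/
theorem isPersistentlyIrreducibleFamily_rescaledReal (hreal : T.IsReal)
    (hirr : T.IsPersistentlyIrreducible) (μ : ℝ) :
    IsPersistentlyIrreducibleFamily (T.rescaledReal μ) := by
  rintro J hJ hJc ⟨t₀, ht₀⟩
  have hinv : ∀ t, t₀ ≤ t → ∀ f ∈ J, realRestrict (T.op t) f ∈ J := fun t ht f hf =>
    (J.smul_mem_iff (Real.exp_ne_zero _)).1 (ht₀ t ht f hf)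
  rcases hirr (complexify J) (isIdeal_complexify hJ) (isClosed_complexify hJc)
    ⟨t₀, fun t ht z hz => by
      rw [map_eq_realRestrict (hreal t) z, SetLike.mem_coe, mem_complexify, rePart_mk, imPart_mk]
      exact ⟨hinv t ht _ hz.1, hinv t ht _ hz.2⟩⟩ with h | h
  · refine Or.inl ((Submodule.eq_bot_iff _).2 fun x hx => ?_)
    have := coe_mem_complexify.2 hx
    rw [h, Submodule.mem_bot] at this
    exact Subtype.ext this
  · exact Or.inr ((Submodule.eq_top_iff'.2 fun x =>
      coe_mem_complexify.1 (h ▸ Submodule.mem_top)))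

/-- The eigenvectors of the generator are the elements whose real and imaginary parts are fixed by
the rescaled semigroup. -/
theorem mem_eigenspace_iff_rescaledReal (hreal : T.IsReal) {μ : ℝ} {z : E} :
    z ∈ eigenspace T.generator (μ : ℂ) ↔
      (∀ t, T.rescaledReal μ t (rePart z) = rePart z) ∧
        ∀ t, T.rescaledReal μ t (imPart z) = imPart z := by
  have hstep : ∀ t : ℝ≥0, T.op t z = Real.exp (μ * t) • z ↔
      T.rescaledReal μ t (rePart z) = rePart z ∧ T.rescaledReal μ t (imPart z) = imPart z := by
    intro t
    have h : Real.exp (-(μ * t)) • T.op t z = (T.rescaledReal μ t (rePart z) : E) +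
        Complex.I • (T.rescaledReal μ t (imPart z) : E) := by
      rw [coe_rescaledReal hreal, coe_rescaledReal hreal, smul_comm Complex.I, ← smul_add,
        ← map_smul (T.op t) Complex.I, ← map_add, rePart_add_I_smul_imPart]
    rw [← inv_smul_eq_iff₀ (Real.exp_ne_zero _), ← Real.exp_neg, h]
    constructor
    · intro h
      have := rePart_imPart_eq h.symm
      exact ⟨this.1.symm, this.2.symm⟩
    · rintro ⟨h1, h2⟩
      rw [h1, h2, rePart_add_I_smul_imPart]
  rw [mem_eigenspace_generator_iff, ← forall_and]
  exact forall_congr' hstep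

theorem realFunctional_rescaledReal [CompleteSpace E] (hreal : T.IsReal) {μ : ℝ}
    {φ : StrongDual ℂ E} (hφ : φ ∈ eigenspace (dual T.generator) (μ : ℂ)) (t : ℝ≥0)
    (x : realPart (E := E)) :
    realFunctional φ (T.rescaledReal μ t x) = realFunctional φ x := by
  change (φ (T.rescaledReal μ t x : E)).re = (φ x).re
  rw [coe_rescaledReal hreal, ← Complex.coe_smul, map_smul, T.eigenspace_dual_op hφ,
    Complex.coe_smul, smul_smul, ← Real.exp_add, neg_add_cancel, Real.exp_zero, one_smul]

end C0Semigroup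

/-! ### The main theorem -/

theorem mainTheorem3 {E : Type*} [NormedAddCommGroup E] [NormedSpace ℂ E] [CompleteSpace E]
    [ComplexBanachLattice E] (T : C0Semigroup E)
    (hreal : T.IsReal) (hpos : T.IsIndividuallyEventuallyPositive)
    (hirr : T.IsPersistentlyIrreducible) (μ : ℝ)
    (hA : UnboundedOperator.IsEigenvalue T.generator (μ : ℂ))
    (hA' : UnboundedOperator.IsEigenvalue (UnboundedOperator.dual T.generator) (μ : ℂ))
    (hφ : ∃ φ ∈ UnboundedOperator.eigenspace (UnboundedOperator.dual T.generator) (μ : ℂ),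
      φ ≠ 0 ∧ ComplexBanachLattice.IsPositiveFunctional φ) :
    UnboundedOperator.IsAlgebraicallySimple T.generator (μ : ℂ) ∧
    (∃ u : ComplexBanachLattice.realPart (E := E), ComplexBanachLattice.IsQuasiInterior u ∧
      UnboundedOperator.eigenspace T.generator (μ : ℂ) = Submodule.span ℂ {(u : E)}) ∧
    (∃ φ ∈ UnboundedOperator.eigenspace (UnboundedOperator.dual T.generator) (μ : ℂ),
      ComplexBanachLattice.IsStrictlyPositiveFunctional φ) := by
  open ComplexBanachLattice UnboundedOperator C0Semigroup in
  obtain ⟨φ, hφA, hφ0, hφpos⟩ := hφ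
  have hS := rescaledReal_eventually_nonneg hreal hpos μ
  have hSirr := isPersistentlyIrreducibleFamily_rescaledReal hreal hirr μ
  have hφS := realFunctional_rescaledReal hreal hφA
  have hstrict : ∀ f : realPart (E := E), 0 ≤ f → realFunctional φ f = 0 → f = 0 := fun f =>
    eq_zero_of_invariant_functional_eq_zero hS hSirr
      (fun f hf => (hφpos f (isPositive_coe.2 hf)).1) (realFunctional_ne_zero hφpos hφ0) hφS
  obtain ⟨z, hz, hz0⟩ := hA
  -- The real and imaginary parts of the eigenvector are both fixed, and at least one is non-zero.
  obtain ⟨w, hw0, hw⟩ : ∃ w : realPart (E := E), w ≠ 0 ∧ ∀ t, T.rescaledReal μ t w = w := by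
    have hz' := (mem_eigenspace_iff_rescaledReal hreal).1 hz
    by_cases h : rePart z = 0
    · refine ⟨imPart z, fun h' => hz0 ?_, hz'.2⟩
      rw [← rePart_add_I_smul_imPart z, h, h']
      simp
    · exact ⟨rePart z, h, hz'.1⟩
  obtain ⟨v, hv, hv0, hSv, hdense, hspan⟩ :=
    exists_quasiInterior_fixed (rescaledReal_add hreal μ) hS hSirr hstrict hφS hw0 hw
  have heig : eigenspace T.generator (μ : ℂ) = Submodule.span ℂ {(v : E)} := by
    ext x
    rw [Submodule.mem_span_singleton]
    constructor
    · intro hx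
      have hx := (mem_eigenspace_iff_rescaledReal hreal).1 hx
      obtain ⟨a, ha⟩ := hspan _ hx.1
      obtain ⟨b, hb⟩ := hspan _ hx.2
      refine ⟨a + Complex.I * b, ?_⟩
      rw [← rePart_add_I_smul_imPart x, ha, hb, add_smul, mul_smul, Complex.coe_smul,
        Complex.coe_smul]
      rfl
    · rintro ⟨c, rfl⟩
      refine Submodule.smul_mem _ _ ((mem_eigenspace_iff_rescaledReal hreal).2 ?_)
      rw [rePart_coe, imPart_coe]
      exact ⟨hSv, fun t => map_zero _⟩
  have hφv : φ v ≠ 0 := fun h => hv0 (hstrict v hv (by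
    rw [← Complex.ofReal_eq_zero, coe_realFunctional hφpos, h]))
  refine ⟨?_, ⟨v, isQuasiInterior_of_topologicalClosure_eq_top hv hdense, heig⟩,
    φ, hφA, hφpos, ?_⟩
  · rw [IsAlgebraicallySimple, generalizedEigenspace_eq_eigenspace, heig]
    · exact finrank_span_singleton fun h => hv0 (Subtype.ext h)
    -- If `(μ - A) x = c • v`, applying `φ` gives `c * φ v = 0`, hence `c = 0`.
    · intro x hx
      rw [heig, Submodule.mem_span_singleton] at hx
      obtain ⟨c, hc⟩ := hx
      have h := congrArg φ hc
      rw [map_sub, map_smul, map_smul, T.eigenspace_dual_apply hφA, smul_eq_mul, smul_eq_mul,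
        sub_self, mul_eq_zero, or_iff_left hφv] at h
      rw [← hc, h, zero_smul]
  · rintro f ⟨hf, hf0⟩ hφf
    have := hstrict ⟨f, hf⟩ hf0 (by
      rw [← Complex.ofReal_eq_zero, coe_realFunctional hφpos]
      exact hφf)
    exact congrArg Subtype.val this
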